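/- Let $k$ be a field. For a finite-dimensional Hopf algebra $A$ over $k$ with multiplication $m$, unit $1$, comultiplication $\Delta$, counit $\varepsilon$ and antipode $S$ (which is bijective, since $A$ is finite-dimensional), let $m_1=\Delta_1=I$ be the identity map of $A$ and, for $n\ge 2$, let $m_n=m\circ(m_{n-1}\otimes I):A^{\otimes n}\to A$ and $\Delta_n=(\Delta_{n-1}\otimes I)\circ\Delta:A\to A^{\otimes n}$. The exponent $\exp(A)\in\{1,2,3,\dots\}\cup\{\infty\}$ is the smallest positive integer $n$ such that $$m_n\circ(I\otimes S^{-2}\otimes S^{-4}\otimes\cdots\otimes S^{-2n+2})\circ\Delta_n=\varepsilon\cdot 1,$$ where $\varepsilon\cdot 1$ denotes the map $a\mapsto\varepsilon(a)1$, and $\exp(A)=\infty$ if no such $n$ exists. Let $H$ be a finite-dimensional Hopf algebra over $k$. Let $H^{op}$ be the Hopf algebra with the same comultiplication, unit and counit as $H$, the opposite multiplication $a\otimes b\mapsto ba$, and antipode $S^{-1}$; let $H^{cop}$ be the Hopf algebra with the same multiplication, unit and counit as $H$, the opposite comultiplication $a\mapsto\sum a_{(2)}\otimes a_{(1)}$,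 where $\Delta(a)=\sum a_{(1)}\otimes a_{(2)}$, and antipode $S^{-1}$. Then $$\exp(H^{cop})=\exp(H^{op})=\exp(H).$$ -/

import Mathlib

namespace HopfExponent

open scoped TensorProduct
open Coalgebra HopfAlgebra WithConv

section Bij
variable {k H : Type*} [Field k] [Ring H] [HopfAlgebra k H]

/-- The antipode reverses the comultiplication. -/
theorem comul_antipode_repr (a : H) :
    comul (R := k) (antipode k a) =
      ∑ i ∈ (ℛ k a).index, antipode k ((ℛ k a).right i) ⊗ₜ[k] antipode k ((ℛ k a).left i) ∧
    ∑ i ∈ (ℛ k a).index, comul (R := k) (antipode k ((ℛ k a).left i)) *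
      ((ℛ k a).right i ⊗ₜ[k] 1) = 1 ⊗ₜ[k] antipode k a := by
  let i₁ : H →ₗ[k] H ⊗[k] H := (Algebra.TensorProduct.includeLeft (R := k) (S := k) (A := H) (B := H)).toLinearMap
  let i₂ : H →ₗ[k] H ⊗[k] H := (Algebra.TensorProduct.includeRight (R := k) (A := H) (B := H)).toLinearMap
  have hd : toConv (comul (R := k) (A := H)) = toConv i₁ * toConv i₂ := by
    ext a
    rw [(ℛ k a).convMul_apply]
    simp [i₁, i₂, (ℛ k a).eq]
  have h1 : toConv i₁ * toConv (i₁ ∘ₗ antipode k) = 1 := by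
    have := LinearMap.algHom_comp_convMul_distrib
      (Algebra.TensorProduct.includeLeft (R := k) (S := k) (A := H) (B := H))
      (toConv LinearMap.id) (toConv (antipode k))
    rw [LinearMap.id_mul_antipode] at this
    apply WithConv.ext
    rw [show toConv i₁ = toConv (i₁ ∘ₗ LinearMap.id) from rfl]
    refine this.symm.trans ?_
    ext a; simp [LinearMap.convOne_def]
  have h2 : toConv i₂ * toConv (i₂ ∘ₗ antipode k) = 1 := by
    have := LinearMap.algHom_comp_convMul_distrib
      (Algebra.TensorProduct.includeRight (R := k) (A := H) (B := H))
      (toConv LinearMap.id) (toConv (antipode k))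
    rw [LinearMap.id_mul_antipode] at this
    apply WithConv.ext
    rw [show toConv i₂ = toConv (i₂ ∘ₗ LinearMap.id) from rfl]
    refine this.symm.trans ?_
    ext a; simp [LinearMap.convOne_def]
    exact ((Algebra.TensorProduct.includeRight (R := k) (A := H) (B := H)).commutes _)
  have h3 : toConv (comul (R := k) ∘ₗ antipode k (A := H)) * toConv (comul (R := k) (A := H)) = 1 := by
    have := LinearMap.algHom_comp_convMul_distrib (Bialgebra.comulAlgHom k H)
      (toConv (antipode k)) (toConv LinearMap.id)
    rw [LinearMap.antipode_mul_id] at this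
    apply WithConv.ext
    refine this.symm.trans ?_
    ext a; simp [LinearMap.convOne_def]
  have h4 : toConv (comul (R := k) (A := H)) *
      (toConv (i₂ ∘ₗ antipode k) * toConv (i₁ ∘ₗ antipode k)) = 1 := by
    rw [hd, mul_assoc, ← mul_assoc (toConv i₂), h2, one_mul, h1]
  have h5 := left_inv_eq_right_inv h3 h4
  have h6 : toConv (i₁ ∘ₗ antipode k) * toConv i₁ = 1 := by
    have := LinearMap.algHom_comp_convMul_distrib
      (Algebra.TensorProduct.includeLeft (R := k) (S := k) (A := H) (B := H))
      (toConv (antipode k)) (toConv LinearMap.id)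
    rw [LinearMap.antipode_mul_id] at this
    apply WithConv.ext
    rw [show toConv i₁ = toConv (i₁ ∘ₗ LinearMap.id) from rfl]
    refine this.symm.trans ?_
    ext a; simp [LinearMap.convOne_def]
  have h7 : toConv (comul (R := k) ∘ₗ antipode k (A := H)) * toConv i₁ =
      toConv (i₂ ∘ₗ antipode k) := by
    rw [h5, mul_assoc, h6, mul_one]
  constructor
  · have := congr($h5 a)
    rw [(ℛ k a).convMul_apply] at this
    simpa [i₁, i₂] using this
  · have := congr($h7 a)
    rw [(ℛ k a).convMul_apply] at this
    simpa [i₁, i₂] using this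

/-- The slice map `a ⊗ b ↦ g b • a`. -/
noncomputable def slice (g : H →ₗ[k] k) : H ⊗[k] H →ₗ[k] H :=
  (TensorProduct.rid k H).toLinearMap ∘ₗ LinearMap.lTensor H g

theorem slice_tmul (g : H →ₗ[k] k) (a b : H) : slice g (a ⊗ₜ b) = g b • a := by
  simp [slice]

theorem slice_mul (g : H →ₗ[k] k) (t : H ⊗[k] H) (a : H) :
    slice g (t * (a ⊗ₜ 1)) = slice g t * a := by
  induction t with
  | zero => simp
  | tmul x y => simp [slice_tmul]
  | add x y hx hy => simp [add_mul, hx, hy]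

theorem slice_comul {ι : Type*} [Fintype ι] (e : Module.Basis ι k H)
    (g : WithConv (H →ₗ[k] k)) (z : H) :
    slice g.ofConv (comul z) = ∑ i, (toConv (e.coord i) * g) z • e i := by
  simp only [(ℛ k z).convMul_apply]
  conv_lhs => rw [← (ℛ k z).eq]
  simp only [map_sum, slice_tmul, Finset.sum_smul]
  rw [Finset.sum_comm]
  refine Finset.sum_congr rfl fun r _ => ?_
  conv_lhs => rw [← e.sum_repr ((ℛ k z).left r)]
  simp only [Finset.smul_sum, smul_smul]
  refine Finset.sum_congr rfl fun i _ => ?_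
  rw [mul_comm]; rfl

theorem comul_eq_sum {ι : Type*} [Fintype ι] (e : Module.Basis ι k H) (z : H) :
    comul (R := k) z =
      ∑ j, ∑ i, (toConv (e.coord j) * toConv (e.coord i)) z • (e j ⊗ₜ[k] e i) := by
  conv_lhs => rw [← (ℛ k z).eq]
  simp only [(ℛ k z).convMul_apply, Finset.sum_smul]
  conv_rhs => enter [2, j]; rw [Finset.sum_comm]
  rw [Finset.sum_comm]
  refine Finset.sum_congr rfl fun r _ => ?_
  conv_lhs => rw [← e.sum_repr ((ℛ k z).left r), ← e.sum_repr ((ℛ k z).right r)]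
  simp only [TensorProduct.sum_tmul, TensorProduct.tmul_sum, TensorProduct.smul_tmul_smul]
  rw [Finset.sum_comm]
  rfl

theorem sum_contract {ι V : Type*} [Fintype ι] [AddCommGroup V] [Module k V]
    (e : Module.Basis ι k H) (B : WithConv (H →ₗ[k] k) →ₗ[k] H ⊗[k] H →ₗ[k] V) :
    ∑ j, ∑ i, B (toConv (e.coord j) * toConv (e.coord i)) (e j ⊗ₜ e i) =
      ∑ l, B (toConv (e.coord l)) (comul (e l)) := by
  have key (g : WithConv (H →ₗ[k] k)) : g = ∑ l, g (e l) • toConv (e.coord l) := by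
    apply WithConv.ext
    refine e.ext fun m => ?_
    have : ((∑ l, g (e l) • toConv (e.coord l)).ofConv : H →ₗ[k] k) =
      ∑ l, g (e l) • e.coord l := by
        rw [WithConv.ofConv_sum]; rfl
    rw [this]
    classical
    simp
  simp_rw [comul_eq_sum e]
  simp only [map_sum, map_smul]
  conv_rhs => rw [Finset.sum_comm]; enter [2, j]; rw [Finset.sum_comm]
  refine Finset.sum_congr rfl fun j _ => Finset.sum_congr rfl fun i _ => ?_
  conv_lhs => rw [key (toConv (e.coord j) * toConv (e.coord i))]
  simp

theorem slice_compat (f : H →ₗ[k] k) (x h : H) :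
    slice f (comul x * (1 ⊗ₜ antipode k h)) =
      ∑ r ∈ (ℛ k h).index,
        slice f (comul (x * antipode k ((ℛ k h).left r))) * (ℛ k h).right r := by
  rw [← (comul_antipode_repr h).2, Finset.mul_sum, map_sum]
  refine Finset.sum_congr rfl fun r _ => ?_
  rw [← mul_assoc, slice_mul, Bialgebra.comul_mul]

theorem slice_compat' (f : H →ₗ[k] k) (x b : H) :
    slice f (comul x * (1 ⊗ₜ antipode k (antipode k b))) =
      ∑ r ∈ (ℛ k b).index,
        slice f (comul (x * antipode k (antipode k ((ℛ k b).right r)))) *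
          antipode k ((ℛ k b).left r) := by
  let R : H ⊗[k] H →ₗ[k] H := LinearMap.mul' k H ∘ₗ LinearMap.rTensor H
    (slice f ∘ₗ comul ∘ₗ LinearMap.mulLeft k x ∘ₗ antipode k)
  have h1 : slice f (comul x * (1 ⊗ₜ antipode k (antipode k b))) =
      R (comul (antipode k b)) := by
    rw [slice_compat]
    conv_rhs => rw [← (ℛ k (antipode k b)).eq]
    simp [R]
  rw [h1, (comul_antipode_repr b).1]
  simp [R]

/-- The functional `x ↦ ∑ i, (e i^* * f) (x S²(e i))`. -/
noncomputable def proj {ι : Type*} [Fintype ι] (e : Module.Basis ι k H)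
    (f : WithConv (H →ₗ[k] k)) : H →ₗ[k] k :=
  ∑ i, (toConv (e.coord i) * f).ofConv ∘ₗ LinearMap.mulRight k (antipode k (antipode k (e i)))

theorem proj_apply {ι : Type*} [Fintype ι] (e : Module.Basis ι k H)
    (f : WithConv (H →ₗ[k] k)) (x : H) :
    proj e f x = ∑ i, (toConv (e.coord i) * f) (x * antipode k (antipode k (e i))) := by
  simp only [proj, LinearMap.sum_apply]; rfl

theorem slice_mulRight (f : H →ₗ[k] k) (s : H) (t : H ⊗[k] H) :
    slice (f ∘ₗ LinearMap.mulRight k s) t = slice f (t * (1 ⊗ₜ s)) := by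
  induction t with
  | zero => simp
  | tmul x y => simp [slice_tmul]
  | add x y hx hy => simp only [map_add, add_mul, hx, hy]

theorem proj_integral {ι : Type*} [Fintype ι] (e : Module.Basis ι k H)
    (f : WithConv (H →ₗ[k] k)) (x : H) :
    slice (proj e f) (comul x) = proj e f x • 1 := by
  let ψ : WithConv (H →ₗ[k] k) → WithConv (H →ₗ[k] H) := fun g =>
    toConv (Algebra.linearMap k H ∘ₗ (g * f).ofConv ∘ₗ LinearMap.mulLeft k x ∘ₗ
      antipode k ∘ₗ antipode k)
  have ψ_apply (g) (b : H) : ψ g b =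
    (g * f) (x * antipode k (antipode k b)) • (1 : H) := by
      rw [← Algebra.algebraMap_eq_smul_one]; rfl
  let B : WithConv (H →ₗ[k] k) →ₗ[k] H ⊗[k] H →ₗ[k] H :=
    { toFun g := LinearMap.mul' k H ∘ₗ LinearMap.lTensor H (toConv (antipode k) * ψ g).ofConv
      map_add' g g' := by
        have : ψ (g + g') = ψ g + ψ g' := by
          ext b; simp [ψ, add_mul, LinearMap.comp_add, LinearMap.add_comp]
        rw [this, mul_add, WithConv.ofConv_add, LinearMap.lTensor_add, LinearMap.comp_add]
      map_smul' c g := by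
        have : ψ (c • g) = c • ψ g := by
          ext b; simp [ψ, LinearMap.comp_smul, LinearMap.smul_comp]
        rw [this, mul_smul_comm, WithConv.ofConv_smul, LinearMap.lTensor_smul,
          LinearMap.comp_smul]; rfl }
  have hB (g) (a b : H) : B g (a ⊗ₜ b) = a * (toConv (antipode k) * ψ g : WithConv (H →ₗ[k] H)) b := rfl
  have hB' (g) (c : H) : B g (comul c) = ψ g c := by
    have : B g (comul c) = (toConv LinearMap.id * (toConv (antipode k) * ψ g) : WithConv (H →ₗ[k] H)) c := rfl
    rw [this, ← mul_assoc, LinearMap.id_mul_antipode, one_mul]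
  have key := sum_contract e B
  simp only [hB', ψ_apply, ← Finset.sum_smul, ← proj_apply] at key
  rw [← key, proj]
  have h0 : ∀ t : H ⊗[k] H, slice (∑ i, (toConv (e.coord i) * f).ofConv ∘ₗ
      LinearMap.mulRight k (antipode k (antipode k (e i)))) t =
      ∑ i, slice (toConv (e.coord i) * f).ofConv
        (t * (1 ⊗ₜ antipode k (antipode k (e i)))) := by
    intro t
    simp only [← slice_mulRight]
    induction t with
    | zero => simp
    | tmul x y => simp [slice_tmul, Finset.sum_smul]
    | add x y hx hy => simp only [map_add, hx, hy, Finset.sum_add_distrib]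
  rw [h0, Finset.sum_comm]
  refine Finset.sum_congr rfl fun i _ => ?_
  rw [slice_compat']
  simp only [slice_comul e, hB, (ℛ k (e i)).convMul_apply, ψ_apply, Finset.mul_sum, Finset.sum_mul]
  rw [Finset.sum_comm]
  refine Finset.sum_congr rfl fun j _ => Finset.sum_congr rfl fun r _ => ?_
  simp [mul_assoc]

theorem sum_proj {ι : Type*} [Fintype ι] (e : Module.Basis ι k H)
    (f : WithConv (H →ₗ[k] k)) (x : H) :
    ∑ i, proj e (toConv (e.coord i) * f) (x * antipode k (e i)) = f x := by
  let B : WithConv (H →ₗ[k] k) →ₗ[k] H ⊗[k] H →ₗ[k] k :=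
    { toFun g := (g * f).ofConv ∘ₗ LinearMap.mulLeft k x ∘ₗ antipode k ∘ₗ LinearMap.mul' k H ∘ₗ
        LinearMap.rTensor H (antipode k)
      map_add' g g' := by
        rw [add_mul, WithConv.ofConv_add, LinearMap.add_comp]
      map_smul' c g := by
        rw [smul_mul_assoc, WithConv.ofConv_smul, LinearMap.smul_comp]; rfl }
  have hB (g) (a b : H) : B g (a ⊗ₜ b) = (g * f) (x * antipode k (antipode k a * b)) := rfl
  have hB' (g) (c : H) : B g (comul c) = (g * f) x * counit (R := k) c := by
    change (g * f) (x * antipode k (LinearMap.mul' k H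
      (LinearMap.rTensor H (antipode k) (comul c)))) = _
    rw [mul_antipode_rTensor_comul_apply, Algebra.algebraMap_eq_smul_one]
    simp [-LinearMap.convMul_apply, mul_comm]
  have key := sum_contract e B
  simp only [hB, hB'] at key
  simp only [proj_apply]
  have h1 : counit (R := k) (slice f.ofConv (comul x)) = f x := by
    conv_lhs => rw [← (ℛ k x).eq]
    have := congr(f $(sum_counit_smul (R := k) (ℛ k x)))
    simp only [map_sum, map_smul, slice_tmul] at this ⊢
    rw [← this]
    simp [mul_comm]
  rw [slice_comul e] at h1
  simp only [map_sum, map_smul, smul_eq_mul] at h1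
  rw [← h1, ← key, Finset.sum_comm]
  refine Finset.sum_congr rfl fun j _ => Finset.sum_congr rfl fun r _ => ?_
  rw [← mul_assoc, antipode_mul_antidistrib, mul_assoc x]

variable (k H) in
/-- A finite-dimensional Hopf algebra has a nonzero integral in its dual. -/
theorem exists_integral [FiniteDimensional k H] [Nontrivial H] :
    ∃ f : H →ₗ[k] k, f ≠ 0 ∧ ∀ x, slice f (comul x) = f x • 1 := by
  by_contra! hcon
  have h0 (g : WithConv (H →ₗ[k] k)) : proj (Module.finBasis k H) g = 0 := by
    by_contra hne
    obtain ⟨x, hx⟩ := hcon _ hne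
    exact hx (proj_integral _ _ _)
  have := sum_proj (Module.finBasis k H) (toConv (counit (R := k) (A := H))) 1
  simp [h0] at this

variable (k H) in
/-- The antipode of a finite-dimensional Hopf algebra is injective, hence bijective. -/
theorem antipode_injective [FiniteDimensional k H] :
    Function.Injective (antipode k (A := H)) := by
  nontriviality H
  obtain ⟨f, hf, hint⟩ := exists_integral k H
  let θ : H →ₗ[k] (H →ₗ[k] k) :=
    (LinearMap.compRight k f) ∘ₗ (LinearMap.mul k H).flip ∘ₗ antipode k
  have hθ (h x : H) : θ h x = f (x * antipode k h) := rfl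
  have hker (h : H) (hh : θ h = 0) : LinearMap.rTensor H θ (comul h) = 0 := by
    apply (dualTensorHomEquiv k H H).injective
    rw [map_zero]
    ext x
    have h1 : dualTensorHomEquiv k H H (LinearMap.rTensor H θ (comul h)) x =
        slice f (comul x * (1 ⊗ₜ antipode k h)) := by
      rw [slice_compat]
      simp only [hint]
      conv_lhs => rw [← (ℛ k h).eq]
      simp [hθ, dualTensorHomEquiv]
    have h2 : f ∘ₗ LinearMap.mulRight k (antipode k h) = 0 := hh
    rw [h1, ← slice_mulRight, h2]
    simp [slice]
  have hex : Function.Exact (LinearMap.rTensor H (LinearMap.ker θ).subtype)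
      (LinearMap.rTensor H θ) :=
    Module.Flat.rTensor_exact H (LinearMap.exact_subtype_ker_map θ)
  have hcounit (h : H) (hh : θ h = 0) : counit (R := k) h = 0 := by
    obtain ⟨t, ht⟩ := (hex _).1 (hker h hh)
    have h1 : ∀ t : LinearMap.ker θ ⊗[k] H, θ (LinearMap.mul' k H (LinearMap.lTensor H (antipode k)
        (LinearMap.rTensor H (LinearMap.ker θ).subtype t))) = 0 := by
      intro t
      induction t with
      | zero => simp
      | tmul a b =>
        ext x
        have := congr($(LinearMap.mem_ker.1 a.2) (x * antipode k (antipode k b)))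
        rw [hθ] at this
        simpa [hθ, antipode_mul_antidistrib, mul_assoc] using this
      | add x y hx hy => simp only [map_add, hx, hy, add_zero]
    have h2 := h1 t
    rw [ht, mul_antipode_lTensor_comul_apply, Algebra.algebraMap_eq_smul_one, map_smul] at h2
    refine (smul_eq_zero.1 h2).resolve_right fun h3 => hf ?_
    ext x
    simpa [hθ] using congr($h3 x)
  rw [← LinearMap.ker_eq_bot, LinearMap.ker_eq_bot']
  intro h hh
  have hθh : θ h = 0 := by ext x; simp [hθ, hh]
  obtain ⟨t, ht⟩ := (hex _).1 (hker h hθh)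
  have h1 : ∀ t : LinearMap.ker θ ⊗[k] H, LinearMap.rTensor H (counit (R := k))
        (LinearMap.rTensor H (LinearMap.ker θ).subtype t) = 0 := by
    intro t
    induction t with
    | zero => simp
    | tmul a b => simp [hcounit _ (LinearMap.mem_ker.1 a.2)]
    | add x y hx hy => simp only [map_add, hx, hy, add_zero]
  have h2 := h1 t
  rw [ht, rTensor_counit_comul] at h2
  simpa using congr(TensorProduct.lid k H $h2)

variable (k H) in
/-- The antipode of a finite-dimensional Hopf algebra, as a linear automorphism. -/
noncomputable def antipodeEquiv [FiniteDimensional k H] : H ≃ₗ[k] H :=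
  LinearEquiv.ofInjectiveEndo (antipode k) (antipode_injective k H)

@[simp]
theorem antipodeEquiv_apply [FiniteDimensional k H] (a : H) :
    antipodeEquiv k H a = antipode k a := rfl

end Bij


section Op
variable {k H : Type*} [Field k] [Ring H]

/-- The opposite multiplication is compatible with the same comultiplication. -/
noncomputable instance [Bialgebra k H] : Bialgebra k Hᵐᵒᵖ :=
  Bialgebra.mk' k Hᵐᵒᵖ
    (by simp [MulOpposite.counit_def])
    (by intro a b; simp [MulOpposite.counit_def, mul_comm])
    (by simp [MulOpposite.comul_def, Algebra.TensorProduct.one_def])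
    (by
      intro a b
      have h : ∀ s t : H ⊗[k] H,
          TensorProduct.map (MulOpposite.opLinearEquiv k).toLinearMap
            (MulOpposite.opLinearEquiv k).toLinearMap (t * s) =
          TensorProduct.map (MulOpposite.opLinearEquiv k).toLinearMap
            (MulOpposite.opLinearEquiv k).toLinearMap s *
          TensorProduct.map (MulOpposite.opLinearEquiv k).toLinearMap
            (MulOpposite.opLinearEquiv k (M := H)).toLinearMap t := by
        intro s t
        induction s with
        | zero => simp
        | add x y hx hy => simp only [mul_add, add_mul, map_add, hx, hy]
        | tmul a b =>
          induction t with
          | zero => simp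
          | add x y hx hy => simp only [mul_add, add_mul, map_add, hx, hy]
          | tmul c d => simp
      simp [MulOpposite.comul_def, h])

variable [HopfAlgebra k H] [FiniteDimensional k H]

theorem antipode_antipodeEquiv_symm (a : H) : antipode k ((antipodeEquiv k H).symm a) = a :=
  (antipodeEquiv k H).apply_symm_apply a

/-- The Hopf algebra `H^op`: opposite multiplication, same comultiplication, antipode `S⁻¹`. -/
noncomputable instance : HopfAlgebra k Hᵐᵒᵖ where
  antipode := (MulOpposite.opLinearEquiv k).toLinearMap ∘ₗ (antipodeEquiv k H).symm.toLinearMap ∘ₗ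
    (MulOpposite.opLinearEquiv k).symm.toLinearMap
  mul_antipode_rTensor_comul := by
    ext a
    apply MulOpposite.unop_injective
    apply antipode_injective k H
    have := sum_mul_antipode_eq_algebraMap_counit (ℛ k (MulOpposite.unop a))
    have h2 := (ℛ k (MulOpposite.unop a)).eq
    simp [MulOpposite.comul_def, MulOpposite.counit_def, ← h2, antipode_mul_antidistrib,
      antipode_antipodeEquiv_symm, this, Algebra.algebraMap_eq_smul_one]
  mul_antipode_lTensor_comul := by
    ext a
    apply MulOpposite.unop_injective
    apply antipode_injective k H
    have := sum_antipode_mul_eq_algebraMap_counit (ℛ k (MulOpposite.unop a))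
    have h2 := (ℛ k (MulOpposite.unop a)).eq
    simp [MulOpposite.comul_def, MulOpposite.counit_def, ← h2, antipode_mul_antidistrib,
      antipode_antipodeEquiv_symm, this, Algebra.algebraMap_eq_smul_one]

end Op

/-- The space `H`, to carry the co-opposite Hopf algebra structure `H^cop`. -/
def Cop (H : Type*) : Type _ := H

section Cop
variable {k H : Type*} [Field k] [Ring H]

instance : Ring (Cop H) := inferInstanceAs (Ring H)
instance [Algebra k H] : Algebra k (Cop H) := inferInstanceAs (Algebra k H)
instance [Algebra k H] [FiniteDimensional k H] : FiniteDimensional k (Cop H) :=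
  inferInstanceAs (FiniteDimensional k H)

variable (k H) in
/-- The identity map `H → H^cop`, an isomorphism of algebras. -/
def toCop [Algebra k H] : H ≃ₐ[k] Cop H := AlgEquiv.refl

section
variable [Bialgebra k H]

/-- The opposite comultiplication `a ↦ ∑ a₂ ⊗ a₁`, with the same counit. -/
noncomputable instance : CoalgebraStruct k (Cop H) where
  comul := TensorProduct.map (toCop k H).toLinearMap (toCop k H).toLinearMap ∘ₗ
    (TensorProduct.comm k H H).toLinearMap ∘ₗ comul ∘ₗ (toCop k H).symm.toLinearMap
  counit := counit ∘ₗ (toCop k H).symm.toLinearMap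

theorem Cop.comul_toCop (a : H) : comul (R := k) (toCop k H a) =
    TensorProduct.map (toCop k H).toLinearMap (toCop k H).toLinearMap
      (TensorProduct.comm k H H (comul a)) := rfl

theorem Cop.counit_toCop (a : H) : counit (R := k) (toCop k H a) = counit (R := k) a := rfl

noncomputable instance : Coalgebra k (Cop H) where
  coassoc := by
    ext a
    obtain ⟨a, rfl⟩ := (toCop k H).surjective a
    let F : H ⊗[k] (H ⊗[k] H) →ₗ[k] Cop H ⊗[k] (Cop H ⊗[k] Cop H) :=
      TensorProduct.map (toCop k H).toLinearMap
        (TensorProduct.map (toCop k H).toLinearMap (toCop k H).toLinearMap) ∘ₗ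
      (TensorProduct.assoc k H H H).toLinearMap ∘ₗ
      (TensorProduct.comm k H H).toLinearMap.rTensor H ∘ₗ
      (TensorProduct.comm k H (H ⊗[k] H)).toLinearMap
    have hF (x y z : H) : F (x ⊗ₜ (y ⊗ₜ z)) =
      toCop k H z ⊗ₜ (toCop k H y ⊗ₜ toCop k H x) := rfl
    have h := congr(F $(coassoc_apply (R := k) a))
    have h1 : ∀ t : H ⊗[k] H, F (TensorProduct.assoc k H H H (comul.rTensor H t)) =
        comul.lTensor (Cop H) (TensorProduct.map (toCop k H).toLinearMap (toCop k H).toLinearMap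
          (TensorProduct.comm k H H t)) := by
      intro t
      induction t with
      | zero => simp
      | add x y hx hy => simp only [map_add, hx, hy]
      | tmul x y =>
        simp only [LinearMap.rTensor_tmul, TensorProduct.comm_tmul, TensorProduct.map_tmul,
          LinearMap.lTensor_tmul, AlgEquiv.toLinearMap_apply, Cop.comul_toCop]
        generalize comul (R := k) x = s
        induction s with
        | zero => simp
        | add x y hx hy => simp only [map_add, TensorProduct.add_tmul, TensorProduct.tmul_add, hx, hy]
        | tmul x z => rfl
    have h2 : ∀ t : H ⊗[k] H, F (comul.lTensor H t) =
        TensorProduct.assoc k (Cop H) (Cop H) (Cop H) (comul.rTensor (Cop H)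
          (TensorProduct.map (toCop k H).toLinearMap (toCop k H).toLinearMap
          (TensorProduct.comm k H H t))) := by
      intro t
      induction t with
      | zero => simp
      | add x y hx hy => simp only [map_add, hx, hy]
      | tmul x y =>
        simp only [LinearMap.rTensor_tmul, TensorProduct.comm_tmul, TensorProduct.map_tmul,
          LinearMap.lTensor_tmul, AlgEquiv.toLinearMap_apply, Cop.comul_toCop]
        generalize comul (R := k) y = s
        induction s with
        | zero => simp
        | add x y hx hy => simp only [map_add, TensorProduct.add_tmul, TensorProduct.tmul_add, hx, hy]
        | tmul y z => rfl
    rw [h1, h2] at h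
    exact h.symm
  rTensor_counit_comp_comul := by
    ext a
    obtain ⟨a, rfl⟩ := (toCop k H).surjective a
    have h := congr((toCop k H).toLinearMap.lTensor k
      (TensorProduct.comm k H k $(lTensor_counit_comul (R := k) a)))
    simp only [LinearMap.comp_apply, Cop.comul_toCop]
    rw [← (ℛ k a).eq] at h ⊢
    simpa only [map_sum, LinearMap.lTensor_tmul, LinearMap.rTensor_tmul, TensorProduct.comm_tmul,
      TensorProduct.map_tmul, AlgEquiv.toLinearMap_apply, Cop.counit_toCop, TensorProduct.mk_apply,
      LinearMap.flip_apply] using h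
  lTensor_counit_comp_comul := by
    ext a
    obtain ⟨a, rfl⟩ := (toCop k H).surjective a
    have h := congr((toCop k H).toLinearMap.rTensor k
      (TensorProduct.comm k k H $(rTensor_counit_comul (R := k) a)))
    simp only [LinearMap.comp_apply, Cop.comul_toCop]
    rw [← (ℛ k a).eq] at h ⊢
    simpa only [map_sum, LinearMap.lTensor_tmul, LinearMap.rTensor_tmul, TensorProduct.comm_tmul,
      TensorProduct.map_tmul, AlgEquiv.toLinearMap_apply, Cop.counit_toCop, TensorProduct.mk_apply,
      LinearMap.flip_apply] using h

noncomputable instance : Bialgebra k (Cop H) :=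
  Bialgebra.mk' k (Cop H)
    (by rw [← map_one (toCop k H), Cop.counit_toCop]; simp)
    (by
      intro a b
      obtain ⟨a, rfl⟩ := (toCop k H).surjective a
      obtain ⟨b, rfl⟩ := (toCop k H).surjective b
      rw [← map_mul]
      simp only [Cop.counit_toCop]
      simp)
    (by
      rw [← map_one (toCop k H), Cop.comul_toCop]
      simp [Algebra.TensorProduct.one_def])
    (by
      intro a b
      obtain ⟨a, rfl⟩ := (toCop k H).surjective a
      obtain ⟨b, rfl⟩ := (toCop k H).surjective b
      rw [← map_mul]
      simp only [Cop.comul_toCop]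
      have h (t : H ⊗[k] H) : TensorProduct.map (toCop k H).toLinearMap (toCop k H).toLinearMap
          (TensorProduct.comm k H H t) = (Algebra.TensorProduct.map (toCop k H).toAlgHom
            (toCop k H).toAlgHom) (Algebra.TensorProduct.comm k H H t) := rfl
      simp only [h, Bialgebra.comul_mul, map_mul])
end

variable [HopfAlgebra k H] [FiniteDimensional k H]

/-- The Hopf algebra `H^cop`: same multiplication, opposite comultiplication, antipode `S⁻¹`. -/
noncomputable instance : HopfAlgebra k (Cop H) where
  antipode := (toCop k H).toLinearMap ∘ₗ (antipodeEquiv k H).symm.toLinearMap ∘ₗ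
    (toCop k H).symm.toLinearMap
  mul_antipode_rTensor_comul := by
    ext a
    obtain ⟨a, rfl⟩ := (toCop k H).surjective a
    apply (toCop k H).symm.injective
    apply antipode_injective k H
    have := sum_antipode_mul_eq_algebraMap_counit (ℛ k a)
    have h2 := (ℛ k a).eq
    simp [Cop.comul_toCop, Cop.counit_toCop, ← h2, antipode_mul_antidistrib,
      antipode_antipodeEquiv_symm, this, Algebra.algebraMap_eq_smul_one]
  mul_antipode_lTensor_comul := by
    ext a
    obtain ⟨a, rfl⟩ := (toCop k H).surjective a
    apply (toCop k H).symm.injective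
    apply antipode_injective k H
    have := sum_mul_antipode_eq_algebraMap_counit (ℛ k a)
    have h2 := (ℛ k a).eq
    simp [Cop.comul_toCop, Cop.counit_toCop, ← h2, antipode_mul_antidistrib,
      antipode_antipodeEquiv_symm, this, Algebra.algebraMap_eq_smul_one]

end Cop

section Exponent
variable (k H : Type*) [Field k] [Ring H]

/-- The iterated coproduct `Δ_n : H → H^{⊗n}`: `Δ_0 = ε`, `Δ_1 = I`, and
`Δ_n = (Δ_{n-1} ⊗ I) ∘ Δ` for `n ≥ 2`. -/
noncomputable def iterComul [Bialgebra k H] : (n : ℕ) → H →ₗ[k] ⨂[k]^n H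
  | 0 => (TensorPower.algebraMap₀ (R := k) (M := H)).toLinearMap ∘ₗ counit
  | 1 => (PiTensorProduct.subsingletonEquiv (R := k) (s := fun _ : Fin 1 => H) 0).symm.toLinearMap
  | n + 2 => (TensorPower.mulEquiv (n := n + 1) (m := 1)).toLinearMap ∘ₗ
      TensorProduct.map (iterComul (n + 1))
        (PiTensorProduct.subsingletonEquiv (R := k) (s := fun _ : Fin 1 => H) 0).symm.toLinearMap ∘ₗ comul

/-- The iterated product `m_n : H^{⊗n} → H`, `x₁ ⊗ ⋯ ⊗ xₙ ↦ x₁ ⋯ xₙ`. -/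
noncomputable def iterMul [Algebra k H] (n : ℕ) : (⨂[k]^n H) →ₗ[k] H :=
  PiTensorProduct.lift (MultilinearMap.mkPiAlgebraFin k n H)

variable [HopfAlgebra k H] [FiniteDimensional k H]

/-- The endomorphism `m_n ∘ (I ⊗ S^{-2} ⊗ ⋯ ⊗ S^{-2n+2}) ∘ Δ_n` of `H`. -/
noncomputable def twistedPower (n : ℕ) : H →ₗ[k] H :=
  iterMul k H n ∘ₗ
    PiTensorProduct.map (fun i : Fin n =>
      ((antipodeEquiv k H ^ (-2 * (i : ℤ)) : H ≃ₗ[k] H) : H →ₗ[k] H)) ∘ₗ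
    iterComul k H n

/-- The exponent of a finite-dimensional Hopf algebra: the smallest positive integer `n` with
`m_n ∘ (I ⊗ S^{-2} ⊗ ⋯ ⊗ S^{-2n+2}) ∘ Δ_n = ε · 1`, and `∞` if there is none. -/
noncomputable def exponent : ℕ∞ :=
  sInf {N : ℕ∞ | ∃ n : ℕ, 0 < n ∧ twistedPower k H n = Algebra.linearMap k H ∘ₗ counit ∧ N = n}

end Exponent

end HopfExponent

/-!
Write `*` for the convolution product on `End H`, whose unit is `ε · 1`. The `n`-th twisted power
of `H` is `T = I * S⁻² * S⁻⁴ * ⋯ * S⁻²ⁿ⁺²` (`twistedPower_succ`). Since `S⁻²ⁱ` is an automorphism,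
its convolution inverse is `S⁻²ⁱ⁺¹`, so `T` is convolution invertible, with inverse
`S⁻²ⁿ⁺³ * ⋯ * S⁻¹ * S = S⁻²ⁿ⁺² ∘ Q`, where `Q = S * S³ * ⋯ * S²ⁿ⁻¹`
(`oddAntipodeProd_mul_twistedPower`). Hence `T = ε · 1` if and only if `Q = ε · 1`.

The twisted powers of `H^op` and `H^cop` are `a ↦ ∑ S²ⁿ⁻²(aₙ) ⋯ S²(a₂) a₁` and
`a ↦ ∑ aₙ S²(aₙ₋₁) ⋯ S²ⁿ⁻²(a₁)`. As `S` reverses products and coproducts, the former followed by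
`S`, and the latter preceded by `S`, are both equal to `Q` (`antipode_unop_twistedPower_op`,
`twistedPower_cop_antipode`). As `S` is bijective and fixes `ε · 1` on either side, the identities
defining the three exponents are equivalent for each `n`.
-/

namespace HopfExponent

open scoped TensorProduct
open Coalgebra HopfAlgebra WithConv

/-! ### The twisted power as a convolution product -/

section Recursion
variable {k H : Type*} [Field k] [Ring H]

theorem subsingletonEquiv_symm_eq_tprod [Algebra k H] (b : H) :
    (PiTensorProduct.subsingletonEquiv (R := k) (s := fun _ : Fin 1 => H) 0).symm b =
      PiTensorProduct.tprod k (fun _ => b) := by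
  rw [LinearEquiv.symm_apply_eq, PiTensorProduct.subsingletonEquiv_apply_tprod]

/-- Appending one more tensor factor multiplies the iterated product on the right. -/
theorem iterMul_map_mulEquiv [Algebra k H] (n : ℕ) (σ : ℕ → H →ₗ[k] H) (x : ⨂[k]^n H) (b : H) :
    iterMul k H (n + 1) (PiTensorProduct.map (fun i : Fin (n + 1) => σ i)
      (TensorPower.mulEquiv (x ⊗ₜ (PiTensorProduct.subsingletonEquiv (R := k)
        (s := fun _ : Fin 1 => H) 0).symm b))) =
    iterMul k H n (PiTensorProduct.map (fun i : Fin n => σ i) x) * σ n b := by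
  induction x using PiTensorProduct.induction_on with
  | smul_tprod r f =>
    rw [subsingletonEquiv_symm_eq_tprod, ← TensorProduct.smul_tmul', map_smul, map_smul, map_smul, map_smul, map_smul,
      smul_mul_assoc, ← TensorPower.gMul_def, TensorPower.tprod_mul_tprod,
      PiTensorProduct.map_tprod, PiTensorProduct.map_tprod]
    have hl (i : Fin n) : Fin.append f (fun _ : Fin 1 => b) i.castSucc = f i :=
      Fin.append_left f _ i
    have hr : Fin.append f (fun _ : Fin 1 => b) (Fin.last n) = b := Fin.append_right f _ 0
    simp only [iterMul, PiTensorProduct.lift.tprod, MultilinearMap.mkPiAlgebraFin_apply,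
      List.ofFn_succ', List.concat_eq_append, List.prod_append, List.prod_singleton, hl, hr,
      Fin.val_castSucc, Fin.val_last]
  | add x y hx hy => simp only [TensorProduct.add_tmul, map_add, hx, hy, add_mul]

variable [HopfAlgebra k H] [FiniteDimensional k H]

variable (k H) in
theorem twistedPower_zero : toConv (twistedPower k H 0) = 1 := by
  ext a
  simp [twistedPower, iterComul, iterMul, TensorPower.algebraMap₀_eq_smul_one,
    TensorPower.gOne_def, PiTensorProduct.map_tprod, Algebra.algebraMap_eq_smul_one]

variable (k H) in
theorem twistedPower_one : twistedPower k H 1 = LinearMap.id := by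
  ext a
  simp [twistedPower, iterComul, iterMul]

variable (k H) in
/-- Hence in the convolution algebra `End H` the `n`-th twisted power is
`I * S⁻² * S⁻⁴ * ⋯ * S⁻²ⁿ⁺²`. -/
theorem twistedPower_succ (n : ℕ) : toConv (twistedPower k H (n + 1)) =
    toConv (twistedPower k H n) *
      toConv ((antipodeEquiv k H ^ (-2 * (n : ℤ)) : H ≃ₗ[k] H) : H →ₗ[k] H) := by
  cases n with
  -- `iterComul` has a separate clause at `1`, which agrees with the general recursion started
  -- from `Δ_0 = ε`.
  | zero =>
    rw [twistedPower_zero, one_mul, zero_add, twistedPower_one]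
    rfl
  | succ n =>
    ext a
    rw [(ℛ k a).convMul_apply]
    change iterMul k H (n + 2) (PiTensorProduct.map _ (TensorPower.mulEquiv (n := n + 1) (m := 1)
      (TensorProduct.map (iterComul k H (n + 1)) _ (comul a)))) = _
    conv_lhs => rw [← (ℛ k a).eq]
    simp only [map_sum, TensorProduct.map_tmul]
    refine Finset.sum_congr rfl fun i _ => ?_
    exact iterMul_map_mulEquiv (n + 1)
      (fun i => ((antipodeEquiv k H ^ (-2 * (i : ℤ)) : H ≃ₗ[k] H) : H →ₗ[k] H)) _ _

end Recursion

/-! ### The convolution inverse of the twisted power -/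

section Inverse
variable {k H : Type*} [Field k] [Ring H] [HopfAlgebra k H]

/-- Composition with an algebra endomorphism of `H`, as an endomorphism of the convolution
monoid of linear maps `H → H`. -/
noncomputable def convPostcomp (F : H →ₐ[k] H) :
    WithConv (H →ₗ[k] H) →* WithConv (H →ₗ[k] H) where
  toFun φ := toConv (F.toLinearMap ∘ₗ φ.ofConv)
  map_one' := by ext a; simp [LinearMap.convOne_def]
  map_mul' φ ψ := WithConv.ext (LinearMap.algHom_comp_convMul_distrib F φ ψ)

theorem convPostcomp_apply (F : H →ₐ[k] H) (φ : WithConv (H →ₗ[k] H)) (a : H) :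
    convPostcomp F φ a = F (φ a) := rfl

theorem convPostcomp_eq_one_iff (F : H ≃ₐ[k] H) (φ : WithConv (H →ₗ[k] H)) :
    convPostcomp (F : H →ₐ[k] H) φ = 1 ↔ φ = 1 := by
  refine ⟨fun h => ?_, fun h => by rw [h, map_one]⟩
  ext a
  apply F.injective
  have := congr($h a)
  rw [convPostcomp_apply] at this
  refine this.trans ?_
  simp [LinearMap.convOne_def]

variable [FiniteDimensional k H]

variable (k H) in
/-- The square of the antipode, as an algebra automorphism. -/
noncomputable def antipodeSq : H ≃ₐ[k] H :=
  AlgEquiv.ofLinearEquiv (antipodeEquiv k H ^ (2 : ℤ))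
    (by
      change antipode k (antipode k (1 : H)) = 1
      rw [antipode_one, antipode_one])
    (fun a b => by
      change antipode k (antipode k (a * b)) =
        antipode k (antipode k a) * antipode k (antipode k b)
      rw [antipode_mul_antidistrib, antipode_mul_antidistrib])

theorem antipodeSq_zpow_apply (z : ℤ) (a : H) :
    (antipodeSq k H ^ z : H ≃ₐ[k] H) a = (antipodeEquiv k H ^ (2 * z) : H ≃ₗ[k] H) a := by
  have h1 (b : H) : (antipodeEquiv k H ^ (2 : ℤ) : H ≃ₗ[k] H) b = antipodeSq k H b := rfl
  rw [zpow_mul]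
  induction z generalizing a with
  | zero => rfl
  | succ n ih =>
    rw [zpow_add_one, zpow_add_one, AlgEquiv.mul_apply, LinearEquiv.mul_apply, ih, h1]
  | pred n ih =>
    rw [zpow_sub_one, zpow_sub_one, AlgEquiv.mul_apply, LinearEquiv.mul_apply, ih]
    rfl

theorem convPostcomp_antipodeSq_antipode (z w : ℤ) :
    convPostcomp (antipodeSq k H ^ z : H ≃ₐ[k] H)
      (toConv ((antipodeEquiv k H ^ w : H ≃ₗ[k] H) : H →ₗ[k] H)) =
      toConv ((antipodeEquiv k H ^ (2 * z + w) : H ≃ₗ[k] H) : H →ₗ[k] H) := by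
  ext a
  rw [convPostcomp_apply]
  change (antipodeSq k H ^ z : H ≃ₐ[k] H) ((antipodeEquiv k H ^ w : H ≃ₗ[k] H) a) =
    (antipodeEquiv k H ^ (2 * z + w) : H ≃ₗ[k] H) a
  rw [antipodeSq_zpow_apply, zpow_add, LinearEquiv.mul_apply]

theorem convPostcomp_antipodeSq_add (z w : ℤ) (φ : WithConv (H →ₗ[k] H)) :
    convPostcomp (antipodeSq k H ^ (z + w) : H ≃ₐ[k] H) φ =
      convPostcomp (antipodeSq k H ^ z : H ≃ₐ[k] H)
        (convPostcomp (antipodeSq k H ^ w : H ≃ₐ[k] H) φ) := by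
  rw [zpow_add]; rfl

variable (k H) in
/-- The twisted power with the new factor split off on the left. -/
theorem twistedPower_succ' (n : ℕ) : toConv (twistedPower k H (n + 1)) =
    toConv LinearMap.id * convPostcomp (antipodeSq k H ^ (-1 : ℤ) : H ≃ₐ[k] H)
      (toConv (twistedPower k H n)) := by
  induction n with
  | zero => rw [twistedPower_zero, map_one, mul_one, zero_add, twistedPower_one]
  | succ n ih =>
    rw [twistedPower_succ, twistedPower_succ k H n, map_mul, ← mul_assoc, ← ih,
      convPostcomp_antipodeSq_antipode, ← twistedPower_succ]
    congr 5
    push_cast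
    ring

variable (k H) in
/-- The convolution product `S * S³ * ⋯ * S²ⁿ⁻¹` of the odd powers of the antipode. -/
noncomputable def oddAntipodeProd : ℕ → WithConv (H →ₗ[k] H)
  | 0 => 1
  | n + 1 => oddAntipodeProd n *
      toConv ((antipodeEquiv k H ^ (2 * (n : ℤ) + 1) : H ≃ₗ[k] H) : H →ₗ[k] H)

variable (k H) in
/-- `S⁻²ⁱ⁺¹` is the convolution inverse of `S⁻²ⁱ`, so the reversed product
`S⁻²ⁿ⁺³ * ⋯ * S⁻¹ * S` inverts the twisted power; it is `S⁻²ⁿ⁺² ∘ (S * S³ * ⋯ * S²ⁿ⁻¹)`. -/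
theorem oddAntipodeProd_mul_twistedPower (n : ℕ) :
    convPostcomp (antipodeSq k H ^ (1 - (n : ℤ)) : H ≃ₐ[k] H) (oddAntipodeProd k H n) *
      toConv (twistedPower k H n) = 1 := by
  induction n with
  | zero => rw [twistedPower_zero, oddAntipodeProd, map_one, mul_one]
  | succ n ih =>
    have h : convPostcomp (antipodeSq k H ^ (1 - ((n + 1 : ℕ) : ℤ)) : H ≃ₐ[k] H)
        (oddAntipodeProd k H (n + 1)) =
        convPostcomp (antipodeSq k H ^ (-1 : ℤ) : H ≃ₐ[k] H)
          (convPostcomp (antipodeSq k H ^ (1 - (n : ℤ)) : H ≃ₐ[k] H) (oddAntipodeProd k H n)) *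
          toConv (antipode k) := by
      rw [oddAntipodeProd, map_mul, convPostcomp_antipodeSq_antipode,
        ← convPostcomp_antipodeSq_add]
      have e1 : (1 : ℤ) - ((n + 1 : ℕ) : ℤ) = -1 + (1 - (n : ℤ)) := by push_cast; ring
      have e2 : 2 * (-1 + (1 - (n : ℤ))) + (2 * (n : ℤ) + 1) = 1 := by ring
      rw [e1, e2, zpow_one]
      rfl
    rw [h, twistedPower_succ', mul_assoc, ← mul_assoc (toConv (antipode k)),
      LinearMap.antipode_mul_id, one_mul, ← map_mul, ih, map_one]

variable (k H) in
/-- A convolution-invertible map is the unit exactly when its inverse is, and `S⁻²ⁿ⁺²` fixes the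
convolution unit. -/
theorem twistedPower_eq_one_iff (n : ℕ) :
    toConv (twistedPower k H n) = 1 ↔ oddAntipodeProd k H n = 1 := by
  have h := oddAntipodeProd_mul_twistedPower k H n
  rw [← convPostcomp_eq_one_iff (antipodeSq k H ^ (1 - (n : ℤ))) (oddAntipodeProd k H n)]
  constructor
  · intro h1; rwa [h1, mul_one] at h
  · intro h1; rwa [h1, one_mul] at h

end Inverse

/-! ### The opposite and co-opposite Hopf algebras -/

section OpCop
variable {k H : Type*} [Field k] [Ring H] [HopfAlgebra k H] [FiniteDimensional k H]

/-- The antipode is an anti-endomorphism of coalgebras. -/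
theorem comul_antipodeEquiv (a : H) : comul (R := k) (antipodeEquiv k H a) =
    ∑ i ∈ (ℛ k a).index,
      antipodeEquiv k H ((ℛ k a).right i) ⊗ₜ[k] antipodeEquiv k H ((ℛ k a).left i) :=
  (comul_antipode_repr a).1

theorem antipodeEquiv_mul (a b : H) : antipodeEquiv k H (a * b) =
    antipodeEquiv k H b * antipodeEquiv k H a :=
  antipode_mul_antidistrib a b

theorem antipodeEquiv_zpow_op (z : ℤ) (a : H) :
    (antipodeEquiv k Hᵐᵒᵖ ^ z : Hᵐᵒᵖ ≃ₗ[k] Hᵐᵒᵖ) (MulOpposite.op a) =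
      MulOpposite.op ((antipodeEquiv k H ^ (-z) : H ≃ₗ[k] H) a) := by
  have h (b : H) : antipodeEquiv k Hᵐᵒᵖ (MulOpposite.op b) =
    MulOpposite.op ((antipodeEquiv k H)⁻¹ b) := rfl
  induction z generalizing a with
  | zero => rfl
  | succ n ih =>
    rw [zpow_add_one, LinearEquiv.mul_apply, h, ih, neg_add, ← sub_eq_add_neg, zpow_sub_one,
      LinearEquiv.mul_apply]
  | pred n ih =>
    have h' : (antipodeEquiv k Hᵐᵒᵖ)⁻¹ (MulOpposite.op a) =
        MulOpposite.op (antipodeEquiv k H a) := by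
      apply (antipodeEquiv k Hᵐᵒᵖ).injective
      rw [h]
      exact ((antipodeEquiv k Hᵐᵒᵖ).apply_symm_apply _).trans
        congr(MulOpposite.op $((antipodeEquiv k H).symm_apply_apply a)).symm
    rw [zpow_sub_one, LinearEquiv.mul_apply, h', ih, neg_sub', sub_neg_eq_add, zpow_add_one,
      LinearEquiv.mul_apply]

theorem antipodeEquiv_zpow_cop (z : ℤ) (a : H) :
    (antipodeEquiv k (Cop H) ^ z : Cop H ≃ₗ[k] Cop H) (toCop k H a) =
      toCop k H ((antipodeEquiv k H ^ (-z) : H ≃ₗ[k] H) a) := by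
  have h (b : H) : antipodeEquiv k (Cop H) (toCop k H b) =
    toCop k H ((antipodeEquiv k H)⁻¹ b) := rfl
  induction z generalizing a with
  | zero => rfl
  | succ n ih =>
    rw [zpow_add_one, LinearEquiv.mul_apply, h, ih, neg_add, ← sub_eq_add_neg, zpow_sub_one,
      LinearEquiv.mul_apply]
  | pred n ih =>
    have h' : (antipodeEquiv k (Cop H))⁻¹ (toCop k H a) =
        toCop k H (antipodeEquiv k H a) := by
      apply (antipodeEquiv k (Cop H)).injective
      rw [h]
      exact ((antipodeEquiv k (Cop H)).apply_symm_apply _).trans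
        congr(toCop k H $((antipodeEquiv k H).symm_apply_apply a)).symm
    rw [zpow_sub_one, LinearEquiv.mul_apply, h', ih, neg_sub', sub_neg_eq_add, zpow_add_one,
      LinearEquiv.mul_apply]

theorem antipodeEquiv_algebraMap (c : k) :
    antipodeEquiv k H (algebraMap k H c) = algebraMap k H c := by
  rw [Algebra.algebraMap_eq_smul_one, map_smul, antipodeEquiv_apply, antipode_one]

/-- `S (S²ⁿ⁻²(aₙ) ⋯ S²(a₂) a₁) = S(a₁) S³(a₂) ⋯ S²ⁿ⁻¹(aₙ)`. -/
theorem antipode_unop_twistedPower_op (n : ℕ) (a : H) :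
    antipodeEquiv k H (MulOpposite.unop (twistedPower k Hᵐᵒᵖ n (MulOpposite.op a))) =
      oddAntipodeProd k H n a := by
  induction n generalizing a with
  | zero =>
    have h := congr($(twistedPower_zero k Hᵐᵒᵖ) (MulOpposite.op a))
    change twistedPower k Hᵐᵒᵖ 0 (MulOpposite.op a) = _ at h
    rw [h]
    exact antipodeEquiv_algebraMap _
  | succ n ih =>
    have h := congr($(twistedPower_succ k Hᵐᵒᵖ n) (MulOpposite.op a))
    change twistedPower k Hᵐᵒᵖ (n + 1) (MulOpposite.op a) = LinearMap.mul' k Hᵐᵒᵖ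
      (TensorProduct.map (twistedPower k Hᵐᵒᵖ n) _ (comul (MulOpposite.op a))) at h
    rw [h, oddAntipodeProd, (ℛ k a).convMul_apply, MulOpposite.comul_def]
    simp only [LinearMap.comp_apply, LinearEquiv.coe_coe, MulOpposite.coe_opLinearEquiv_symm,
      MulOpposite.unop_op]
    conv_lhs => rw [← (ℛ k a).eq]
    simp only [map_sum, TensorProduct.map_tmul, LinearEquiv.coe_coe,
      MulOpposite.coe_opLinearEquiv, antipodeEquiv_zpow_op, LinearMap.mul'_apply,
      MulOpposite.unop_mul, MulOpposite.unop_op, Finset.unop_sum, antipodeEquiv_mul, ih]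
    refine Finset.sum_congr rfl fun i _ => ?_
    congr 1
    rw [← LinearEquiv.mul_apply, ← zpow_one_add]
    change _ = (antipodeEquiv k H ^ (2 * (n : ℤ) + 1) : H ≃ₗ[k] H) _
    congr 2
    ring

/-- As the antipode reverses the comultiplication, substituting `S(a)` in
`aₙ S²(aₙ₋₁) ⋯ S²ⁿ⁻²(a₁)` gives `S(a₁) S³(a₂) ⋯ S²ⁿ⁻¹(aₙ)`. -/
theorem twistedPower_cop_antipode (n : ℕ) (a : H) :
    twistedPower k (Cop H) n (toCop k H (antipodeEquiv k H a)) =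
      toCop k H (oddAntipodeProd k H n a) := by
  induction n generalizing a with
  | zero =>
    have h := congr($(twistedPower_zero k (Cop H)) (toCop k H (antipodeEquiv k H a)))
    change twistedPower k (Cop H) 0 _ = algebraMap k (Cop H) (counit (R := k)
      (antipodeEquiv k H a)) at h
    rw [h, antipodeEquiv_apply, counit_antipode]
    rfl
  | succ n ih =>
    have h := congr($(twistedPower_succ k (Cop H) n) (toCop k H (antipodeEquiv k H a)))
    change twistedPower k (Cop H) (n + 1) _ = LinearMap.mul' k (Cop H)
      (TensorProduct.map (twistedPower k (Cop H) n) _ (comul _)) at h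
    rw [h, oddAntipodeProd, (ℛ k a).convMul_apply, Cop.comul_toCop, comul_antipodeEquiv]
    simp only [map_sum, TensorProduct.map_tmul, TensorProduct.comm_tmul, LinearEquiv.coe_coe,
      AlgEquiv.toLinearMap_apply, antipodeEquiv_zpow_cop, LinearMap.mul'_apply, ih, map_mul]
    refine Finset.sum_congr rfl fun i _ => ?_
    congr 2
    rw [← LinearEquiv.mul_apply, ← zpow_add_one]
    change _ = (antipodeEquiv k H ^ (2 * (n : ℤ) + 1) : H ≃ₗ[k] H) _
    congr 2
    ring

variable (k H) in
theorem twistedPower_op_eq_one_iff (n : ℕ) :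
    toConv (twistedPower k Hᵐᵒᵖ n) = 1 ↔ oddAntipodeProd k H n = 1 := by
  constructor
  · intro h
    ext a
    rw [← antipode_unop_twistedPower_op]
    have := congr($h (MulOpposite.op a))
    change twistedPower k Hᵐᵒᵖ n (MulOpposite.op a) = _ at this
    rw [this]
    exact antipodeEquiv_algebraMap _
  · intro h
    ext a
    apply MulOpposite.unop_injective
    apply (antipodeEquiv k H).injective
    refine (antipode_unop_twistedPower_op n (MulOpposite.unop a)).trans ?_
    rw [h]
    exact (antipodeEquiv_algebraMap _).symm

variable (k H) in
theorem twistedPower_cop_eq_one_iff (n : ℕ) :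
    toConv (twistedPower k (Cop H) n) = 1 ↔ oddAntipodeProd k H n = 1 := by
  have h1 (a : H) : (1 : WithConv (Cop H →ₗ[k] Cop H)) (toCop k H (antipodeEquiv k H a)) =
      toCop k H ((1 : WithConv (H →ₗ[k] H)) a) := by
    change toCop k H (algebraMap k H (counit (R := k) (antipode k a))) = _
    rw [counit_antipode]
    rfl
  constructor
  · intro h
    ext a
    apply (toCop k H).injective
    rw [← twistedPower_cop_antipode, ← h1, ← h]
  · intro h
    ext a
    obtain ⟨a, rfl⟩ := (toCop k H).surjective a
    obtain ⟨a, rfl⟩ := (antipodeEquiv k H).surjective a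
    refine (twistedPower_cop_antipode n a).trans ?_
    rw [h, h1]

end OpCop

end HopfExponent

theorem corollary2p6 {k H : Type*} [Field k] [Ring H] [HopfAlgebra k H]
    [FiniteDimensional k H] :
    HopfExponent.exponent k (HopfExponent.Cop H) = HopfExponent.exponent k Hᵐᵒᵖ ∧
      HopfExponent.exponent k Hᵐᵒᵖ = HopfExponent.exponent k H := by
  open HopfExponent WithConv in
  have key (A : Type _) [Ring A] [HopfAlgebra k A] [FiniteDimensional k A]
      (h : ∀ n, toConv (twistedPower k A n) = 1 ↔ oddAntipodeProd k H n = 1) :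
      exponent k A = sInf {N : ℕ∞ | ∃ n : ℕ, 0 < n ∧ oddAntipodeProd k H n = 1 ∧ N = n} := by
    have h2 (n : ℕ) : twistedPower k A n = Algebra.linearMap k A ∘ₗ Coalgebra.counit ↔
        oddAntipodeProd k H n = 1 :=
      ⟨fun e => (h n).1 (WithConv.ext e), fun e => congr(ofConv $((h n).2 e))⟩
    simp only [exponent, h2]
  rw [key _ (HopfExponent.twistedPower_cop_eq_one_iff k H),
    key _ (HopfExponent.twistedPower_op_eq_one_iff k H),
    key H (HopfExponent.twistedPower_eq_one_iff k H)]
  exact ⟨rfl, rfl⟩
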